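/- Let $a$, $b$, $c$ be finite-dimensional quantum systems with $\dim a\ge 2$, let $\rho$ be a state (density matrix) of the bipartite system $ab$, and let $\Phi$ be a completely positive trace-preserving (CPTP) linear map from operators on $b$ to operators on $c$ (for instance $c=b$). Fix a measurement strength $x\in\mathbb R$ and put $\tau_1=\sqrt{(1-\tanh x)/2}$, $\tau_2=\sqrt{(1+\tanh x)/2}$. A weak measurement $\Omega$ of strength $x$ on $a$ is given by two nonzero orthogonal projectors $\Pi^1,\Pi^2$ on $a$ with $\Pi^1+\Pi^2=\mathbb 1$, through $\Omega_x=\tau_1\Pi^1+\tau_2\Pi^2$, $\Omega_{-x}=\tau_2\Pi^1+\tau_1\Pi^2$ and $\Omega(X)=\sum_{k=\pm x}(\Omega_k\otimes\mathbb 1)X(\Omega_k\otimes\mathbb 1)$. For a bipartite state $\sigma$ with marginals $\sigma^a,\sigma^b$ put $$C_H(\sigma|\Omega)=\|\sqrt\sigma-\Omega(\sqrt\sigma)\|^2,\qquad \Delta_w(\sigma|\Omega)=C_H(\sigma|\Omega)-C_H(\sigma^a\otimes\sigma^b|\Omega),\qquad \mathcal Q_w(\sigma)=\min_\Omega\Delta_w(\sigma|\Omega),$$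 where $\|O\|=\sqrt{\operatorname{tr}(O^\dagger O)}$ is the Hilbert–Schmidt norm and the minimum is over all weak measurements $\Omega$ of strength $x$ on $a$. Then the minima defining $\mathcal Q_w(\rho)$ and $\mathcal Q_w((\mathbb 1\otimes\Phi)\rho)$ are attained, and $$\mathcal Q_w\big((\mathbb 1\otimes\Phi)\rho\big)\le\mathcal Q_w(\rho).$$ -/

import Mathlib

namespace WeakCorrelation

open scoped Kronecker MatrixOrder ComplexOrder

noncomputable section

/-- A density matrix (quantum state): positive semidefinite with unit trace. -/
def IsState {n : Type*} [Fintype n] (ρ : Matrix n n ℂ) : Prop :=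
  ρ.PosSemidef ∧ ρ.trace = 1

/-- The marginal on the first subsystem (partial trace over the second one). -/
def marginalA {a b : Type*} [Fintype b] (ρ : Matrix (a × b) (a × b) ℂ) : Matrix a a ℂ :=
  Matrix.of fun i i' => ∑ j, ρ (i, j) (i', j)

/-- The marginal on the second subsystem (partial trace over the first one). -/
def marginalB {a b : Type*} [Fintype a] (ρ : Matrix (a × b) (a × b) ℂ) : Matrix b b ℂ :=
  Matrix.of fun j j' => ∑ i, ρ (i, j) (i, j')

/-- The map `1 ⊗ Φ`: `Φ` is applied to every block `(X (i, ·) (i', ·))`, so that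
`(1 ⊗ Φ) (A ⊗ B) = A ⊗ Φ B`. -/
def idTensor (a : Type*) {b c : Type*} (Φ : Matrix b b ℂ →ₗ[ℂ] Matrix c c ℂ)
    (X : Matrix (a × b) (a × b) ℂ) : Matrix (a × c) (a × c) ℂ :=
  Matrix.of fun p q => Φ (Matrix.of fun j j' => X (p.1, j) (q.1, j')) p.2 q.2

/-- Completely positive and trace preserving linear maps. -/
structure IsCPTP {b c : Type*} [Fintype b] [Fintype c]
    (Φ : Matrix b b ℂ →ₗ[ℂ] Matrix c c ℂ) : Prop where
  completelyPositive : ∀ (k : ℕ) (X : Matrix (Fin k × b) (Fin k × b) ℂ),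
    X.PosSemidef → (idTensor (Fin k) Φ X).PosSemidef
  tracePreserving : ∀ X : Matrix b b ℂ, (Φ X).trace = X.trace

/-- The Hilbert-Schmidt norm `√(tr (O† O))`. -/
def hsNorm {n : Type*} [Fintype n] (O : Matrix n n ℂ) : ℝ :=
  Real.sqrt (Matrix.trace (O.conjTranspose * O)).re

/-- Two nonzero orthogonal projectors which add up to the identity. -/
structure IsProjectorPair {a : Type*} [Fintype a] [DecidableEq a]
    (P Q : Matrix a a ℂ) : Prop where
  left_proj : IsStarProjection P
  right_proj : IsStarProjection Q
  add_eq_one : P + Q = 1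
  left_ne_zero : P ≠ 0
  right_ne_zero : Q ≠ 0

/-- `τ₁ = √((1 - tanh x) / 2)`. -/
def tau1 (x : ℝ) : ℝ := Real.sqrt ((1 - Real.tanh x) / 2)

/-- `τ₂ = √((1 + tanh x) / 2)`. -/
def tau2 (x : ℝ) : ℝ := Real.sqrt ((1 + Real.tanh x) / 2)

/-- The weak measurement operator `Ω_x = τ₁ P + τ₂ Q`. -/
def weakPlus {a : Type*} (x : ℝ) (P Q : Matrix a a ℂ) : Matrix a a ℂ :=
  (tau1 x : ℂ) • P + (tau2 x : ℂ) • Q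

/-- The weak measurement operator `Ω_{-x} = τ₂ P + τ₁ Q`. -/
def weakMinus {a : Type*} (x : ℝ) (P Q : Matrix a a ℂ) : Matrix a a ℂ :=
  (tau2 x : ℂ) • P + (tau1 x : ℂ) • Q

/-- The weak measurement on subsystem `a` of a bipartite system:
`Ω(X) = ∑_{k = ±x} (Ω_k ⊗ 1) X (Ω_k ⊗ 1)`. -/
def weakMeasure {a b : Type*} [Fintype a] [Fintype b] [DecidableEq b] (x : ℝ)
    (P Q : Matrix a a ℂ) (X : Matrix (a × b) (a × b) ℂ) : Matrix (a × b) (a × b) ℂ :=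
  (weakPlus x P Q ⊗ₖ (1 : Matrix b b ℂ)) * X * (weakPlus x P Q ⊗ₖ (1 : Matrix b b ℂ)) +
  (weakMinus x P Q ⊗ₖ (1 : Matrix b b ℂ)) * X * (weakMinus x P Q ⊗ₖ (1 : Matrix b b ℂ))

/-- The coherence relative to a weak measurement, `C_H(ρ|Ω) = ‖√ρ - Ω(√ρ)‖²`. -/
def coherence {a b : Type*} [Fintype a] [DecidableEq a] [Fintype b] [DecidableEq b] (x : ℝ)
    (P Q : Matrix a a ℂ) (ρ : Matrix (a × b) (a × b) ℂ) : ℝ :=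
  hsNorm (CFC.sqrt ρ - weakMeasure x P Q (CFC.sqrt ρ)) ^ 2

/-- The correlation function `Δ_w(ρ|Ω) = C_H(ρ|Ω) - C_H(ρᵃ ⊗ ρᵇ|Ω)`. -/
def Delta {a b : Type*} [Fintype a] [DecidableEq a] [Fintype b] [DecidableEq b] (x : ℝ)
    (P Q : Matrix a a ℂ) (ρ : Matrix (a × b) (a × b) ℂ) : ℝ :=
  coherence x P Q ρ - coherence x P Q (marginalA ρ ⊗ₖ marginalB ρ)

/-- All values of `Δ_w(ρ|Ω)`, where `Ω` runs over the weak measurements of strength `x` on `a`. -/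
def DeltaValues {a b : Type*} [Fintype a] [DecidableEq a] [Fintype b] [DecidableEq b] (x : ℝ)
    (ρ : Matrix (a × b) (a × b) ℂ) : Set ℝ :=
  {r | ∃ P Q : Matrix a a ℂ, IsProjectorPair P Q ∧ r = Delta x P Q ρ}

/-- The quantum correlation `Q_w(ρ) = min_Ω Δ_w(ρ|Ω)` at measurement strength `x`. -/
def Qw {a b : Type*} [Fintype a] [DecidableEq a] [Fintype b] [DecidableEq b] (x : ℝ)
    (ρ : Matrix (a × b) (a × b) ℂ) : ℝ :=
  sInf (DeltaValues x ρ)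

end

end WeakCorrelation

namespace WeakCorrelation

open scoped Kronecker MatrixOrder ComplexOrder

open Matrix

/-! Write R = √ρ and p = P ⊗ 1. Since Q = 1 - P and τ₁² + τ₂² = 1, a weak measurement keeps the
diagonal blocks of R and scales the off-diagonal ones by 2τ₁τ₂. Hence C_H(ρ|Ω) = 2(1 - 2τ₁τ₂)² (tr
pρ - tr pRpR) (`coherence_eq`). The linear term sees only ρᵃ and cancels in Δ_w, leaving tr P√ρᵃP√ρᵃ
- tr pRpR up to a nonnegative factor (`Delta_eq`). As 1 ⊗ Φ fixes ρᵃ, it suffices that tr pRpR does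
not decrease. This is Lieb's inequality (`re_trace_dual_sqrt_le`) for the Kraus operators 1 ⊗ V k,
whose dual map sends P ⊗ 1 to P ⊗ 1.

For Lieb's inequality, let E be the dual map and σ the output state. Expanding ‖R E(X) - E(Y) R‖² ≥
0 and using the Kadison-Schwarz inequality bounds 2 Re tr(E(X)† R E(Y) R) by tr X†σX + tr YσY†. Left
and right multiplication by σ commute, so they are simultaneously diagonal, and the form on X = Y is
bounded by their geometric mean tr X†√σX√σ (`re_form_le_sum_sqrt_mul`).

The minima exist because projector pairs form a compact set. A minimizer for ρ then competes in the
minimum for (1 ⊗ Φ)ρ. -/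

/-! ### Geometric mean bound for Hermitian forms -/

/-- If a Hermitian form is dominated off the diagonal by two positive diagonal forms, then it is
dominated by their geometric mean. -/
theorem re_form_le_sum_sqrt_mul_of_pos {I : Type*} [Fintype I] [DecidableEq I]
    {Z : Matrix I I ℂ} (hZ : Z.IsHermitian) {l r : I → ℝ} (hl : ∀ i, 0 < l i) (hr : ∀ i, 0 < r i)
    (h : ∀ x y : I → ℂ, 2 * (star x ⬝ᵥ Z *ᵥ y).re ≤
      ∑ i, l i * ‖x i‖ ^ 2 + ∑ i, r i * ‖y i‖ ^ 2) (x : I → ℂ) :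
    (star x ⬝ᵥ Z *ᵥ x).re ≤ ∑ i, √(l i * r i) * ‖x i‖ ^ 2 := by
  -- Fourth roots: with D = diag(g)⁻¹, the claim is exactly D Z D ≤ 1.
  set g : I → ℝ := fun i => √√(l i * r i) with hg
  have hg0 : ∀ i, 0 < g i := fun i => Real.sqrt_pos.2 (Real.sqrt_pos.2 (mul_pos (hl i) (hr i)))
  have hgc : ∀ i, (g i : ℂ) ≠ 0 := fun i => by exact_mod_cast (hg0 i).ne'
  have hg2 : ∀ i, g i ^ 2 = √(l i * r i) := fun i => Real.sq_sqrt (Real.sqrt_nonneg _)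
  have hg4 : ∀ i, g i ^ 2 * g i ^ 2 = l i * r i := fun i => by
    rw [hg2, Real.mul_self_sqrt (mul_pos (hl i) (hr i)).le]
  set D : Matrix I I ℂ := diagonal fun i => ((g i)⁻¹ : ℂ) with hD
  have hDh : Dᴴ = D := by
    simp only [hD, diagonal_conjTranspose]
    congr 1; ext i; simp
  have hB : (1 - D * Z * D).IsHermitian := by
    simp only [IsHermitian, conjTranspose_sub, conjTranspose_mul, conjTranspose_one, hDh, hZ.eq,
      Matrix.mul_assoc]
  have hpsd : (1 - D * Z * D).PosSemidef := by
    rw [hB.posSemidef_iff_eigenvalues_nonneg]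
    intro i
    set μ : ℝ := hB.eigenvalues i with hμ
    set v : I → ℂ := ⇑(hB.eigenvectorBasis i) with hv
    have hv0 : v ≠ 0 := by
      intro h0
      apply (hB.eigenvectorBasis.orthonormal.ne_zero i)
      ext j
      exact congrFun h0 j
    have hev := hB.mulVec_eigenvectorBasis i
    have hcoord : ∀ j, (Z *ᵥ (fun k => (g k : ℂ)⁻¹ * v k)) j = (1 - μ) * g j * v j := by
      intro j
      have h1 := congrFun hev j
      rw [sub_mulVec, one_mulVec, ← mulVec_mulVec, ← mulVec_mulVec] at h1
      have h2 : D *ᵥ v = fun k => (g k : ℂ)⁻¹ * v k := by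
        ext k; rw [hD, mulVec_diagonal]
      rw [← hv, h2] at h1
      simp only [Pi.sub_apply, hD, mulVec_diagonal, Pi.smul_apply] at h1
      rw [← hμ, Complex.real_smul] at h1
      have h3 : (g j : ℂ)⁻¹ * (Z *ᵥ (fun k => (g k : ℂ)⁻¹ * v k)) j = (1 - μ) * v j := by
        linear_combination -h1
      rw [inv_mul_eq_iff_eq_mul₀ (hgc j)] at h3
      rw [h3]; ring
    -- Since g⁴ = l r, these two test vectors give both diagonal forms the same value S, and Z D v =
    -- (1 - μ) g v turns the hypothesis into 2(1 - μ)S ≤ 2S.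
    have key := h (fun k => (g k / l k : ℝ) * v k) (fun k => (g k : ℂ)⁻¹ * v k)
    set S : ℝ := ∑ k, g k ^ 2 / l k * ‖v k‖ ^ 2 with hS
    have e1 : (star (fun k => ((g k / l k : ℝ) : ℂ) * v k) ⬝ᵥ
        Z *ᵥ (fun k => (g k : ℂ)⁻¹ * v k)).re = (1 - μ) * S := by
      rw [dotProduct, Complex.re_sum, hS, Finset.mul_sum]
      refine Finset.sum_congr rfl fun k _ => ?_
      rw [hcoord]
      have : star (fun k => ((g k / l k : ℝ) : ℂ) * v k) k * ((1 - μ) * g k * v k) =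
          (((1 - μ) * (g k ^ 2 / l k * ‖v k‖ ^ 2) : ℝ) : ℂ) := by
        have h4 : (starRingEnd ℂ) (v k) * v k = ((‖v k‖ ^ 2 : ℝ) : ℂ) := by
          rw [mul_comm, Complex.mul_conj, Complex.normSq_eq_norm_sq]
        simp only [Pi.star_apply, star_mul', Complex.star_def, Complex.conj_ofReal]
        push_cast at h4 ⊢
        linear_combination ((g k : ℂ) / l k * (1 - μ) * g k) * h4
      rw [this, Complex.ofReal_re]
    have e2 : ∑ k, l k * ‖((g k / l k : ℝ) : ℂ) * v k‖ ^ 2 = S := by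
      refine Finset.sum_congr rfl fun k _ => ?_
      have := (hl k).ne'
      rw [norm_mul, mul_pow, Complex.norm_real, Real.norm_eq_abs, sq_abs]
      field_simp
    have e3 : ∑ k, r k * ‖(g k : ℂ)⁻¹ * v k‖ ^ 2 = S := by
      refine Finset.sum_congr rfl fun k _ => ?_
      have h5 := (hl k).ne'
      have h6 := (hg0 k).ne'
      rw [norm_mul, mul_pow, norm_inv, Complex.norm_real, Real.norm_eq_abs, inv_pow, sq_abs,
        ← mul_assoc]
      congr 1
      have := hg4 k
      field_simp
      linarith
    rw [e1, e2, e3] at key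
    have hSpos : 0 < S := by
      obtain ⟨j, hj⟩ := Function.ne_iff.1 hv0
      refine Finset.sum_pos' (fun k _ => ?_) ⟨j, Finset.mem_univ _, ?_⟩
      · have := hl k; positivity
      · have := hl j
        have := hg0 j
        have : 0 < ‖v j‖ := norm_pos_iff.2 hj
        positivity
    change 0 ≤ μ
    nlinarith
  have hx := hpsd.re_dotProduct_nonneg (fun i => (g i : ℂ) * x i)
  have hDx : D *ᵥ (fun i => (g i : ℂ) * x i) = x := by
    ext i
    rw [hD, mulVec_diagonal, inv_mul_cancel_left₀ (hgc i)]
  have hxD : star (fun i => (g i : ℂ) * x i) ᵥ* D = star x := by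
    rw [← hDh, ← star_mulVec, hDx]
  rw [sub_mulVec, dotProduct_sub, one_mulVec, ← mulVec_mulVec, hDx, ← mulVec_mulVec,
    dotProduct_mulVec _ D, hxD, map_sub] at hx
  have hn : RCLike.re (star (fun i => (g i : ℂ) * x i) ⬝ᵥ fun i => (g i : ℂ) * x i) =
      ∑ i, √(l i * r i) * ‖x i‖ ^ 2 := by
    rw [dotProduct, map_sum]
    refine Finset.sum_congr rfl fun k _ => ?_
    rw [← hg2, Pi.star_apply, Complex.star_def, ← Complex.normSq_eq_conj_mul_self,
      Complex.normSq_eq_norm_sq, norm_mul, mul_pow, Complex.norm_real, Real.norm_eq_abs, sq_abs]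
    exact Complex.ofReal_re _
  rw [hn] at hx
  exact sub_nonneg.1 hx

/-- If a Hermitian form is dominated off the diagonal by two nonnegative diagonal forms, then it is
dominated by their geometric mean. -/
theorem re_form_le_sum_sqrt_mul {I : Type*} [Fintype I] [DecidableEq I]
    {Z : Matrix I I ℂ} (hZ : Z.IsHermitian) {l r : I → ℝ} (hl : ∀ i, 0 ≤ l i) (hr : ∀ i, 0 ≤ r i)
    (h : ∀ x y : I → ℂ, 2 * (star x ⬝ᵥ Z *ᵥ y).re ≤
      ∑ i, l i * ‖x i‖ ^ 2 + ∑ i, r i * ‖y i‖ ^ 2) (x : I → ℂ) :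
    (star x ⬝ᵥ Z *ᵥ x).re ≤ ∑ i, √(l i * r i) * ‖x i‖ ^ 2 := by
  -- Shifting both weights by ε > 0 reduces to the positive case; then ε → 0.
  have hc : Continuous fun ε : ℝ => ∑ i, √((l i + ε) * (r i + ε)) * ‖x i‖ ^ 2 := by fun_prop
  have ht := (hc.tendsto 0).mono_left (nhdsWithin_le_nhds (s := Set.Ioi 0))
  simp only [add_zero] at ht
  refine ge_of_tendsto ht ?_
  filter_upwards [self_mem_nhdsWithin] with ε hε
  have hε : 0 < ε := hε
  refine re_form_le_sum_sqrt_mul_of_pos hZ (fun i => by linarith [hl i])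
    (fun i => by linarith [hr i]) (fun x y => (h x y).trans ?_) x
  gcongr <;> linarith

/-! ### Trace inequalities and Lieb's inequality -/

/-- The squared Hilbert-Schmidt norm is the sum of the squared moduli of the entries. -/
theorem re_trace_conjTranspose_mul_self {m n : Type*} [Fintype m] [Fintype n]
    (A : Matrix m n ℂ) : (Aᴴ * A).trace.re = ∑ i, ∑ j, ‖A i j‖ ^ 2 := by
  rw [Finset.sum_comm]
  simp only [trace, diag, mul_apply, conjTranspose_apply, Complex.re_sum]
  refine Finset.sum_congr rfl fun j _ => Finset.sum_congr rfl fun i _ => ?_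
  rw [Complex.star_def, ← Complex.normSq_eq_conj_mul_self, Complex.ofReal_re,
    Complex.normSq_eq_norm_sq]

theorem re_trace_conjTranspose_mul_self_nonneg {m n : Type*} [Fintype m] [Fintype n]
    (A : Matrix m n ℂ) : 0 ≤ (Aᴴ * A).trace.re := by
  rw [re_trace_conjTranspose_mul_self]; positivity

theorem re_trace_conjTranspose {n : Type*} [Fintype n] (A : Matrix n n ℂ) :
    Aᴴ.trace.re = A.trace.re := by
  rw [trace_conjTranspose, Complex.star_def, Complex.conj_re]

/-- The Hilbert-Schmidt form of the Kadison-Schwarz inequality: right multiplication by a row of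
operators `W k` with `∑ (W k)ᴴ W k = 1` is contractive. -/
theorem re_trace_sum_mul_le {κ l m n : Type*} [Fintype κ] [Fintype l] [Fintype m] [Fintype n]
    [DecidableEq n] (W : κ → Matrix m n ℂ) (hW : ∑ k, (W k)ᴴ * W k = 1) (N : κ → Matrix l m ℂ) :
    ((∑ k, N k * W k)ᴴ * ∑ k, N k * W k).trace.re ≤ ∑ k, ((N k)ᴴ * N k).trace.re := by
  set M := ∑ k, N k * W k with hM
  -- By ∑ (W k)ᴴ W k = 1, this sum expands to ∑ ‖N k‖² - 2‖M‖² + ‖M‖².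
  have h0 : 0 ≤ ∑ k, ((N k - M * (W k)ᴴ)ᴴ * (N k - M * (W k)ᴴ)).trace.re :=
    Finset.sum_nonneg fun k _ => re_trace_conjTranspose_mul_self_nonneg _
  have h1 : ∀ k, ((N k - M * (W k)ᴴ)ᴴ * (N k - M * (W k)ᴴ)).trace.re =
      ((N k)ᴴ * N k).trace.re - 2 * (Mᴴ * (N k * W k)).trace.re +
        (Mᴴ * M * ((W k)ᴴ * W k)).trace.re := by
    intro k
    have e1 : ((N k)ᴴ * (M * (W k)ᴴ)).trace.re = (Mᴴ * (N k * W k)).trace.re := by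
      rw [← re_trace_conjTranspose, conjTranspose_mul, conjTranspose_mul, conjTranspose_conjTranspose,
        conjTranspose_conjTranspose, Matrix.mul_assoc, trace_mul_comm, Matrix.mul_assoc]
    have e2 : (W k * Mᴴ * N k).trace.re = (Mᴴ * (N k * W k)).trace.re := by
      rw [Matrix.mul_assoc, trace_mul_comm, Matrix.mul_assoc]
    have e3 : (W k * Mᴴ * (M * (W k)ᴴ)).trace.re = (Mᴴ * M * ((W k)ᴴ * W k)).trace.re := by
      rw [Matrix.mul_assoc, trace_mul_comm]
      simp only [Matrix.mul_assoc]
    rw [conjTranspose_sub, conjTranspose_mul, conjTranspose_conjTranspose, Matrix.sub_mul,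
      Matrix.mul_sub, Matrix.mul_sub, trace_sub, trace_sub, trace_sub, Complex.sub_re,
      Complex.sub_re, Complex.sub_re, e1, e2, e3]
    ring
  have h2 : ∑ k, (Mᴴ * (N k * W k)).trace.re = (Mᴴ * M).trace.re := by
    rw [← Complex.re_sum, ← trace_sum, ← Matrix.mul_sum, ← hM]
  have h3 : ∑ k, (Mᴴ * M * ((W k)ᴴ * W k)).trace.re = (Mᴴ * M).trace.re := by
    rw [← Complex.re_sum, ← trace_sum, ← Matrix.mul_sum, hW, Matrix.mul_one]
  simp only [h1, Finset.sum_add_distrib, Finset.sum_sub_distrib, ← Finset.mul_sum] at h0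
  rw [h2, h3] at h0
  linarith

/-- Lieb's inequality at exponent `1/2` in an eigenbasis of the output state: if
`∑ W k R² (W k)ᴴ` is diagonal with entries `s`, then for the dual map `E X = ∑ (W k)ᴴ X W k`,
`tr ((E X)ᴴ R (E X) R) ≤ ∑ √(s i) √(s j) |X i j|²`. -/
theorem re_trace_dual_le_sum {κ m n : Type*} [Fintype κ] [Fintype m] [Fintype n]
    [DecidableEq m] [DecidableEq n] (W : κ → Matrix m n ℂ) (hW : ∑ k, (W k)ᴴ * W k = 1)
    {R : Matrix n n ℂ} (hR : Rᴴ = R) {s : m → ℝ} (hs : ∀ i, 0 ≤ s i)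
    (hσ : ∑ k, W k * (R * R) * (W k)ᴴ = diagonal fun i => (s i : ℂ)) (X : Matrix m m ℂ) :
    ((∑ k, (W k)ᴴ * X * W k)ᴴ * R * (∑ k, (W k)ᴴ * X * W k) * R).trace.re ≤
      ∑ i, ∑ j, √(s i) * √(s j) * ‖X i j‖ ^ 2 := by
  set E : Matrix m m ℂ → Matrix n n ℂ := fun X => ∑ k, (W k)ᴴ * X * W k with hE
  have hEstar : ∀ X, (E X)ᴴ = E Xᴴ := fun X => by
    simp [hE, conjTranspose_sum, Matrix.mul_assoc]
  set G : κ → κ → Matrix m m ℂ := fun a b => W a * R * (W b)ᴴ with hG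
  have hGstar : ∀ a b, (G a b)ᴴ = G b a := fun a b => by
    simp [hG, hR, Matrix.mul_assoc]
  -- The matrix, in `vec` coordinates, of Y ↦ ∑ G a b * Y * G b a, which represents the sesquilinear
  -- form tr((E X)ᴴ R (E Y) R).
  set Z : Matrix (m × m) (m × m) ℂ := ∑ a, ∑ b, (G b a)ᵀ ⊗ₖ G a b with hZdef
  have hZ : Z.IsHermitian := by
    rw [IsHermitian, hZdef, conjTranspose_sum]
    simp only [conjTranspose_sum]
    rw [Finset.sum_comm]
    refine Finset.sum_congr rfl fun a _ => Finset.sum_congr rfl fun b _ => ?_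
    have e : (G a b)ᵀᴴ = (G b a)ᵀ := by rw [← hGstar a b]; rfl
    rw [conjTranspose_kronecker, hGstar, e]
  have hform : ∀ X Y, star (vec X) ⬝ᵥ Z *ᵥ vec Y = ((E X)ᴴ * R * E Y * R).trace := by
    intro X Y
    have h1 : Z *ᵥ vec Y = vec (∑ a, ∑ b, G a b * Y * G b a) := by
      rw [hZdef, sum_mulVec, vec_sum]
      refine Finset.sum_congr rfl fun a _ => ?_
      rw [sum_mulVec, vec_sum]
      refine Finset.sum_congr rfl fun b _ => ?_
      rw [kronecker_mulVec_vec, transpose_transpose]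
    rw [h1, star_vec_dotProduct_vec, hEstar]
    simp only [hE, hG, Matrix.sum_mul, Matrix.mul_sum, trace_sum]
    rw [Finset.sum_comm]
    refine Finset.sum_congr rfl fun a _ => Finset.sum_congr rfl fun b _ => ?_
    simp only [Matrix.mul_assoc]
    rw [trace_mul_comm (W _)ᴴ]
    simp only [Matrix.mul_assoc]
  have hleft : ∀ X, ((R * E X)ᴴ * (R * E X)).trace.re ≤ ∑ i, ∑ j, s i * ‖X i j‖ ^ 2 := by
    intro X
    have h1 := re_trace_sum_mul_le W hW fun k => R * (W k)ᴴ * X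
    have h2 : ∑ k, R * (W k)ᴴ * X * W k = R * E X := by
      simp only [hE, Matrix.mul_sum, Matrix.mul_assoc]
    rw [h2, ← Complex.re_sum, ← trace_sum] at h1
    refine h1.trans_eq ?_
    have h3 : ∑ k, (R * (W k)ᴴ * X)ᴴ * (R * (W k)ᴴ * X) =
        Xᴴ * (diagonal fun i => (s i : ℂ)) * X := by
      rw [← hσ, Matrix.mul_sum, Matrix.sum_mul]
      refine Finset.sum_congr rfl fun k _ => ?_
      simp only [conjTranspose_mul, conjTranspose_conjTranspose, hR, Matrix.mul_assoc]
    rw [h3, Finset.sum_comm, trace, Complex.re_sum]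
    refine Finset.sum_congr rfl fun j _ => ?_
    rw [diag_apply, mul_apply, Complex.re_sum]
    refine Finset.sum_congr rfl fun i _ => ?_
    have h4 : star (X i j) * s i * X i j = ((s i * ‖X i j‖ ^ 2 : ℝ) : ℂ) := by
      rw [mul_right_comm, Complex.star_def, ← Complex.normSq_eq_conj_mul_self,
        Complex.normSq_eq_norm_sq, mul_comm]
      push_cast; rfl
    rw [mul_diagonal, conjTranspose_apply, h4, Complex.ofReal_re]
  have hright : ∀ X, ((E X * R)ᴴ * (E X * R)).trace.re ≤ ∑ i, ∑ j, s j * ‖X i j‖ ^ 2 := by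
    intro X
    have h1 := hleft Xᴴ
    rw [← hEstar, trace_mul_comm] at h1
    rw [Finset.sum_comm]
    simpa [hR] using h1
  have hbound : ∀ X Y, 2 * ((E X)ᴴ * R * E Y * R).trace.re ≤
      (∑ i, ∑ j, s i * ‖X i j‖ ^ 2) + ∑ i, ∑ j, s j * ‖Y i j‖ ^ 2 := by
    intro X Y
    -- The cross term of this square is the form itself.
    have h0 := re_trace_conjTranspose_mul_self_nonneg (R * E X - E Y * R)
    have e2 : ((E Y * R)ᴴ * (R * E X)).trace.re = ((R * E X)ᴴ * (E Y * R)).trace.re := by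
      rw [← re_trace_conjTranspose, conjTranspose_mul _ (R * E X), conjTranspose_conjTranspose]
    have e1 : ((R * E X)ᴴ * (E Y * R)).trace.re = ((E X)ᴴ * R * E Y * R).trace.re := by
      rw [conjTranspose_mul, hR]; simp only [Matrix.mul_assoc]
    rw [conjTranspose_sub, Matrix.sub_mul, Matrix.mul_sub, Matrix.mul_sub, trace_sub, trace_sub,
      trace_sub, Complex.sub_re, Complex.sub_re, Complex.sub_re, e2, e1] at h0
    linarith [hleft X, hright Y]
  -- `vec` stacks columns, so the row index of X is the second coordinate.
  have key := re_form_le_sum_sqrt_mul hZ (l := fun p => s p.2) (r := fun p => s p.1)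
    (fun p => hs _) (fun p => hs _) (fun x y => by
      have := hbound (Matrix.of fun i j => x (j, i)) (Matrix.of fun i j => y (j, i))
      rw [← hform] at this
      rw [Fintype.sum_prod_type_right, Fintype.sum_prod_type_right]
      exact this) (vec X)
  rw [hform, Fintype.sum_prod_type_right] at key
  refine key.trans_eq (Finset.sum_congr rfl fun i _ => Finset.sum_congr rfl fun j _ => ?_)
  rw [Real.sqrt_mul (hs _), vec]

theorem sqrt_posSemidef {n : Type*} [Fintype n] [DecidableEq n] (A : Matrix n n ℂ) :
    (CFC.sqrt A).PosSemidef :=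
  nonneg_iff_posSemidef.1 (CFC.sqrt_nonneg A)

theorem sqrt_mul_sqrt {n : Type*} [Fintype n] [DecidableEq n] {A : Matrix n n ℂ}
    (hA : A.PosSemidef) : CFC.sqrt A * CFC.sqrt A = A :=
  CFC.sqrt_mul_sqrt_self A hA.nonneg

theorem sqrt_eq_of_mul_self {n : Type*} [Fintype n] [DecidableEq n] {A B : Matrix n n ℂ}
    (h : B * B = A) (hB : B.PosSemidef) : CFC.sqrt A = B :=
  CFC.sqrt_unique h hB.nonneg

theorem sqrt_kronecker {m n : Type*} [Fintype m] [DecidableEq m] [Fintype n] [DecidableEq n]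
    {A : Matrix m m ℂ} {B : Matrix n n ℂ} (hA : A.PosSemidef) (hB : B.PosSemidef) :
    CFC.sqrt (A ⊗ₖ B) = CFC.sqrt A ⊗ₖ CFC.sqrt B :=
  sqrt_eq_of_mul_self (by rw [← mul_kronecker_mul, sqrt_mul_sqrt hA, sqrt_mul_sqrt hB])
    ((sqrt_posSemidef A).kronecker (sqrt_posSemidef B))

/-- A positive semidefinite matrix and its square root are diagonalized by the same unitary. -/
theorem exists_unitary_diagonalization {n : Type*} [Fintype n] [DecidableEq n]
    {A : Matrix n n ℂ} (hA : A.PosSemidef) :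
    ∃ (U : Matrix n n ℂ) (s : n → ℝ), Uᴴ * U = 1 ∧ U * Uᴴ = 1 ∧ (∀ i, 0 ≤ s i) ∧
      A = U * (diagonal fun i => (s i : ℂ)) * Uᴴ ∧
      CFC.sqrt A = U * (diagonal fun i => ((√(s i) : ℝ) : ℂ)) * Uᴴ := by
  have h1 : (hA.isHermitian.eigenvectorUnitary : Matrix n n ℂ)ᴴ *
      (hA.isHermitian.eigenvectorUnitary : Matrix n n ℂ) = 1 :=
    Unitary.coe_star_mul_self hA.isHermitian.eigenvectorUnitary
  have h2 : (hA.isHermitian.eigenvectorUnitary : Matrix n n ℂ) *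
      (hA.isHermitian.eigenvectorUnitary : Matrix n n ℂ)ᴴ = 1 :=
    Unitary.coe_mul_star_self hA.isHermitian.eigenvectorUnitary
  have h3 : A = hA.isHermitian.eigenvectorUnitary *
      (diagonal fun i => (hA.isHermitian.eigenvalues i : ℂ)) *
        (hA.isHermitian.eigenvectorUnitary : Matrix n n ℂ)ᴴ :=
    hA.isHermitian.spectral_theorem
  have h4 := hA.eigenvalues_nonneg
  generalize (hA.isHermitian.eigenvectorUnitary : Matrix n n ℂ) = U at h1 h2 h3
  generalize hA.isHermitian.eigenvalues = s at h3 h4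
  refine ⟨U, s, h1, h2, h4, h3, sqrt_eq_of_mul_self ?_ ?_⟩
  · have : U * (diagonal fun i => ((√(s i) : ℝ) : ℂ)) * Uᴴ *
        (U * (diagonal fun i => ((√(s i) : ℝ) : ℂ)) * Uᴴ) =
        U * (diagonal fun i => ((√(s i) : ℝ) : ℂ)) * (Uᴴ * U) *
          (diagonal fun i => ((√(s i) : ℝ) : ℂ)) * Uᴴ := by
      simp only [Matrix.mul_assoc]
    rw [this, h1, Matrix.mul_one, Matrix.mul_assoc U, diagonal_mul_diagonal, h3]
    congr 3
    ext i
    rw [← Complex.ofReal_mul, Real.mul_self_sqrt (h4 i)]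
  · refine PosSemidef.mul_mul_conjTranspose_same (posSemidef_diagonal_iff.2 fun i => ?_) U
    exact Complex.zero_le_real.2 (Real.sqrt_nonneg _)

/-- **Lieb's inequality** at exponent `1/2`: monotonicity of `tr (Kᴴ √σ K √σ)` under a trace
preserving map with Kraus operators `W k`. -/
theorem re_trace_dual_sqrt_le {κ m n : Type*} [Fintype κ] [Fintype m] [Fintype n]
    [DecidableEq m] [DecidableEq n] (W : κ → Matrix m n ℂ) (hW : ∑ k, (W k)ᴴ * W k = 1)
    {ρ : Matrix n n ℂ} (hρ : ρ.PosSemidef) {σ : Matrix m m ℂ} (hσ : σ.PosSemidef)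
    (h : ∑ k, W k * ρ * (W k)ᴴ = σ) (K : Matrix m m ℂ) :
    ((∑ k, (W k)ᴴ * K * W k)ᴴ * CFC.sqrt ρ * (∑ k, (W k)ᴴ * K * W k) * CFC.sqrt ρ).trace.re ≤
      (Kᴴ * CFC.sqrt σ * K * CFC.sqrt σ).trace.re := by
  obtain ⟨U, s, hU1, hU2, hs, hσU, hsqrt⟩ := exists_unitary_diagonalization hσ
  -- Rotating the Kraus operators by Uᴴ makes the output state diagonal.
  have key := re_trace_dual_le_sum (fun k => Uᴴ * W k) (s := s) (R := CFC.sqrt ρ) ?_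
    (sqrt_posSemidef ρ).isHermitian hs ?_ (Uᴴ * K * U)
  · have e1 : ∀ k, (Uᴴ * W k)ᴴ * (Uᴴ * K * U) * (Uᴴ * W k) = (W k)ᴴ * K * W k := fun k => by
      have : (Uᴴ * W k)ᴴ * (Uᴴ * K * U) * (Uᴴ * W k) =
          (W k)ᴴ * (U * Uᴴ) * K * (U * Uᴴ) * W k := by
        simp only [conjTranspose_mul, conjTranspose_conjTranspose, Matrix.mul_assoc]
      rw [this, hU2, Matrix.mul_one, Matrix.mul_one]
    simp only [e1] at key
    refine key.trans_eq ?_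
    rw [hsqrt]
    set T : Matrix m m ℂ := diagonal fun i => ((√(s i) : ℝ) : ℂ) with hT
    have e2 : (Kᴴ * (U * T * Uᴴ) * K * (U * T * Uᴴ)).trace =
        ((Uᴴ * K * U)ᴴ * T * (Uᴴ * K * U) * T).trace := by
      have : Kᴴ * (U * T * Uᴴ) * K * (U * T * Uᴴ) =
          (Kᴴ * U * T * Uᴴ * K * U * T) * Uᴴ := by simp only [Matrix.mul_assoc]
      rw [this, trace_mul_comm]
      simp only [conjTranspose_mul, conjTranspose_conjTranspose, Matrix.mul_assoc]
    rw [e2, trace, Complex.re_sum, Finset.sum_comm]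
    refine Finset.sum_congr rfl fun j _ => ?_
    rw [diag_apply, hT, mul_diagonal, mul_apply, Finset.sum_mul, Complex.re_sum]
    refine Finset.sum_congr rfl fun i _ => ?_
    rw [mul_diagonal, conjTranspose_apply]
    have h4 : ∀ z : ℂ, star z * (√(s i) : ℝ) * z * (√(s j) : ℝ) =
        ((√(s i) * √(s j) * ‖z‖ ^ 2 : ℝ) : ℂ) := fun z => by
      rw [mul_right_comm (star z), Complex.star_def, ← Complex.normSq_eq_conj_mul_self,
        Complex.normSq_eq_norm_sq]
      push_cast; ring
    rw [h4, Complex.ofReal_re]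
  · refine Eq.trans (Finset.sum_congr rfl fun k _ => ?_) hW
    rw [conjTranspose_mul, conjTranspose_conjTranspose, Matrix.mul_assoc, ← Matrix.mul_assoc U,
      hU2, Matrix.one_mul]
  · rw [sqrt_mul_sqrt hρ]
    have : ∑ k, Uᴴ * W k * ρ * (Uᴴ * W k)ᴴ = Uᴴ * σ * U := by
      rw [← h, Matrix.mul_sum, Matrix.sum_mul]
      refine Finset.sum_congr rfl fun k _ => ?_
      simp only [conjTranspose_mul, conjTranspose_conjTranspose, Matrix.mul_assoc]
    rw [this, hσU]
    have : Uᴴ * (U * (diagonal fun i => (s i : ℂ)) * Uᴴ) * U =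
        (Uᴴ * U) * (diagonal fun i => (s i : ℂ)) * (Uᴴ * U) := by simp only [Matrix.mul_assoc]
    rw [this, hU1, Matrix.one_mul, Matrix.mul_one]

/-! ### Kraus operators and the map 1 ⊗ Φ -/

/-- Every completely positive trace preserving map has a Kraus decomposition. -/
theorem IsCPTP.exists_kraus {b c : Type*} [Fintype b] [DecidableEq b] [Fintype c] [DecidableEq c]
    {Φ : Matrix b b ℂ →ₗ[ℂ] Matrix c c ℂ} (hΦ : IsCPTP Φ) :
    ∃ V : (Fin (Fintype.card b) × c) → Matrix c b ℂ,
      ∑ k, (V k)ᴴ * V k = 1 ∧ ∀ X, Φ X = ∑ k, V k * X * (V k)ᴴ := by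
  set e := Fintype.equivFin b
  -- The unnormalized maximally entangled vector: applying 1 ⊗ Φ to its projector gives the Choi
  -- matrix. The rows of a factor B with C = Bᴴ B yield the Kraus operators.
  set w : Fin (Fintype.card b) × b → ℂ := fun p => if p.1 = e p.2 then 1 else 0 with hw
  have hC := hΦ.completelyPositive _ _ (posSemidef_vecMulVec_self_star w)
  obtain ⟨B, hB⟩ := CStarAlgebra.nonneg_iff_eq_star_mul_self.mp hC.nonneg
  have hentry : ∀ i j p q, Φ (single i j 1) p q = ∑ k, star (B k (e i, p)) * B k (e j, q) := by
    intro i j p q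
    have h1 := congrFun (congrFun hB (e i, p)) (e j, q)
    rw [star_eq_conjTranspose, mul_apply] at h1
    simp only [conjTranspose_apply] at h1
    rw [← h1, idTensor, of_apply]
    refine congrArg (fun M => Φ M p q) ?_
    ext j1 j2
    by_cases h1 : i = j1 <;> by_cases h2 : j = j2 <;>
      simp [hw, vecMulVec_apply, h1, h2]
  have hk : ∀ X, Φ X = ∑ k, (Matrix.of fun p i => star (B k (e i, p))) * X *
      (Matrix.of fun p i => star (B k (e i, p)))ᴴ := by
    intro X
    ext p q
    conv_lhs => rw [matrix_eq_sum_single X]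
    simp only [map_sum, Matrix.sum_apply]
    have h2 : ∀ i j, Φ (single i j (X i j)) p q =
        ∑ k, star (B k (e i, p)) * X i j * B k (e j, q) := fun i j => by
      have : single i j (X i j) = X i j • single i j (1 : ℂ) := by simp
      rw [this, map_smul, Matrix.smul_apply, hentry, smul_eq_mul, Finset.mul_sum]
      exact Finset.sum_congr rfl fun k _ => by ring
    simp only [h2, mul_apply, Finset.sum_mul, conjTranspose_apply, of_apply, star_star]
    rw [Finset.sum_comm' (t' := Finset.univ) (s' := fun _ => Finset.univ) (by simp)]
    rw [Finset.sum_congr rfl fun j _ => Finset.sum_comm, Finset.sum_comm]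
  refine ⟨fun k => Matrix.of fun p i => star (B k (e i, p)), ?_, hk⟩
  -- The trace pairing is nondegenerate, so trace preservation forces ∑ (V k)ᴴ V k = 1.
  rw [ext_iff_trace_mul_right]
  intro X
  rw [Matrix.one_mul, ← hΦ.tracePreserving X, hk X, Matrix.sum_mul, trace_sum, trace_sum]
  refine Finset.sum_congr rfl fun k _ => ?_
  rw [Matrix.mul_assoc, trace_mul_comm]

/-- A Kraus decomposition of `Φ` gives one of `1 ⊗ Φ`. -/
theorem idTensor_eq_sum {a b c κ : Type*} [Fintype a] [DecidableEq a] [Fintype b] [Fintype c]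
    [Fintype κ] {Φ : Matrix b b ℂ →ₗ[ℂ] Matrix c c ℂ} {V : κ → Matrix c b ℂ}
    (h : ∀ X, Φ X = ∑ k, V k * X * (V k)ᴴ) (X : Matrix (a × b) (a × b) ℂ) :
    idTensor a Φ X = ∑ k, ((1 : Matrix a a ℂ) ⊗ₖ V k) * X * ((1 : Matrix a a ℂ) ⊗ₖ V k)ᴴ := by
  ext ⟨i, p⟩ ⟨j, q⟩
  simp only [idTensor, of_apply, h, Matrix.sum_apply, mul_apply, conjTranspose_kronecker,
    conjTranspose_one, kroneckerMap_apply, Fintype.sum_prod_type, one_apply, conjTranspose_apply,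
    ite_mul, one_mul, zero_mul, mul_ite, mul_zero, Finset.sum_ite_irrel, Finset.sum_const_zero,
    Finset.sum_ite_eq, Finset.sum_ite_eq', Finset.mem_univ, if_true]

theorem idTensor_posSemidef {a b c : Type*} [Fintype a] [DecidableEq a] [Fintype b] [DecidableEq b]
    [Fintype c] [DecidableEq c] {Φ : Matrix b b ℂ →ₗ[ℂ] Matrix c c ℂ} (hΦ : IsCPTP Φ)
    {X : Matrix (a × b) (a × b) ℂ} (hX : X.PosSemidef) : (idTensor a Φ X).PosSemidef := by
  obtain ⟨V, -, hV⟩ := hΦ.exists_kraus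
  rw [idTensor_eq_sum hV]
  exact posSemidef_sum _ fun k _ => hX.mul_mul_conjTranspose_same _

/-- `tr (√ρ (P ⊗ 1) √ρ (P ⊗ 1))` does not decrease under a CPTP map on the second subsystem. -/
theorem re_trace_sqrt_idTensor_le {a b c : Type*} [Fintype a] [DecidableEq a] [Fintype b]
    [DecidableEq b] [Fintype c] [DecidableEq c] {Φ : Matrix b b ℂ →ₗ[ℂ] Matrix c c ℂ}
    (hΦ : IsCPTP Φ) {ρ : Matrix (a × b) (a × b) ℂ} (hρ : ρ.PosSemidef) {P : Matrix a a ℂ}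
    (hP : Pᴴ = P) :
    ((P ⊗ₖ (1 : Matrix b b ℂ)) * CFC.sqrt ρ * (P ⊗ₖ (1 : Matrix b b ℂ)) * CFC.sqrt ρ).trace.re ≤
      ((P ⊗ₖ (1 : Matrix c c ℂ)) * CFC.sqrt (idTensor a Φ ρ) * (P ⊗ₖ (1 : Matrix c c ℂ)) *
        CFC.sqrt (idTensor a Φ ρ)).trace.re := by
  obtain ⟨V, hV1, hV⟩ := hΦ.exists_kraus
  have hE : ∀ K : Matrix a a ℂ, ∑ k, ((1 : Matrix a a ℂ) ⊗ₖ V k)ᴴ * (K ⊗ₖ (1 : Matrix c c ℂ)) *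
      ((1 : Matrix a a ℂ) ⊗ₖ V k) = K ⊗ₖ (1 : Matrix b b ℂ) := fun K => by
    rw [← hV1]
    ext ⟨i, p⟩ ⟨j, q⟩
    simp only [conjTranspose_kronecker, ← mul_kronecker_mul, conjTranspose_one, Matrix.one_mul,
      Matrix.mul_one, Matrix.sum_apply, kroneckerMap_apply, Finset.mul_sum]
  have hW : ∑ k, ((1 : Matrix a a ℂ) ⊗ₖ V k)ᴴ * ((1 : Matrix a a ℂ) ⊗ₖ V k) = 1 := by
    simpa only [one_kronecker_one, Matrix.mul_one] using hE 1
  have key := re_trace_dual_sqrt_le (fun k => (1 : Matrix a a ℂ) ⊗ₖ V k)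
    hW hρ (idTensor_posSemidef hΦ hρ) (idTensor_eq_sum hV ρ).symm
    (P ⊗ₖ (1 : Matrix c c ℂ))
  have hPs : (P ⊗ₖ (1 : Matrix b b ℂ))ᴴ = P ⊗ₖ (1 : Matrix b b ℂ) := by
    rw [conjTranspose_kronecker, hP, conjTranspose_one]
  have hPs' : (P ⊗ₖ (1 : Matrix c c ℂ))ᴴ = P ⊗ₖ (1 : Matrix c c ℂ) := by
    rw [conjTranspose_kronecker, hP, conjTranspose_one]
  rw [hE, hPs, hPs'] at key
  exact key

/-! ### Coherence as skew information -/

theorem tau1_sq_add_tau2_sq (x : ℝ) : tau1 x ^ 2 + tau2 x ^ 2 = 1 := by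
  have h := Real.abs_tanh_lt_one x
  rw [abs_lt] at h
  rw [tau1, tau2, Real.sq_sqrt (by linarith), Real.sq_sqrt (by linarith)]
  ring

theorem IsProjectorPair.mul_self {a : Type*} [Fintype a] [DecidableEq a] {P Q : Matrix a a ℂ}
    (h : IsProjectorPair P Q) : P * P = P := h.left_proj.isIdempotentElem

theorem IsProjectorPair.conjTranspose_eq {a : Type*} [Fintype a] [DecidableEq a]
    {P Q : Matrix a a ℂ} (h : IsProjectorPair P Q) : Pᴴ = P := h.left_proj.isSelfAdjoint

theorem IsProjectorPair.right_eq {a : Type*} [Fintype a] [DecidableEq a]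
    {P Q : Matrix a a ℂ} (h : IsProjectorPair P Q) : Q = 1 - P := eq_sub_of_add_eq' h.add_eq_one

/-- The part of an operator removed by a weak measurement. -/
theorem sub_weakMeasure {a b : Type*} [Fintype a] [DecidableEq a] [Fintype b] [DecidableEq b]
    (x : ℝ) {P Q : Matrix a a ℂ} (h : IsProjectorPair P Q) (X : Matrix (a × b) (a × b) ℂ) :
    X - weakMeasure x P Q X = ((1 - 2 * tau1 x * tau2 x : ℝ) : ℂ) •
      ((P ⊗ₖ (1 : Matrix b b ℂ)) * X * (1 - P ⊗ₖ (1 : Matrix b b ℂ)) +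
        (1 - P ⊗ₖ (1 : Matrix b b ℂ)) * X * (P ⊗ₖ (1 : Matrix b b ℂ))) := by
  have hτ : (tau1 x : ℂ) ^ 2 + (tau2 x : ℂ) ^ 2 = 1 := by exact_mod_cast tau1_sq_add_tau2_sq x
  have hq : Q ⊗ₖ (1 : Matrix b b ℂ) = 1 - P ⊗ₖ (1 : Matrix b b ℂ) := by
    rw [h.right_eq, ← one_kronecker_one, eq_sub_iff_add_eq, ← add_kronecker, sub_add_cancel]
  set p := P ⊗ₖ (1 : Matrix b b ℂ)
  set t1 : ℂ := (tau1 x : ℂ) with ht1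
  set t2 : ℂ := (tau2 x : ℂ) with ht2
  have h1 : weakPlus x P Q ⊗ₖ (1 : Matrix b b ℂ) = t1 • p + t2 • (1 - p) := by
    rw [weakPlus, add_kronecker, smul_kronecker, smul_kronecker, hq]
  have h2 : weakMinus x P Q ⊗ₖ (1 : Matrix b b ℂ) = t2 • p + t1 • (1 - p) := by
    rw [weakMinus, add_kronecker, smul_kronecker, smul_kronecker, hq]
  rw [weakMeasure, h1, h2]
  have hX : X = p * X * p + p * X * (1 - p) + (1 - p) * X * p + (1 - p) * X * (1 - p) := by
    have h1 : X = (p + (1 - p)) * X * (p + (1 - p)) := by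
      rw [add_sub_cancel, one_mul, mul_one]
    refine h1.trans ?_
    simp only [add_mul, mul_add]
    abel
  have hΩ : (t1 • p + t2 • (1 - p)) * X * (t1 • p + t2 • (1 - p)) +
      (t2 • p + t1 • (1 - p)) * X * (t2 • p + t1 • (1 - p)) =
      (t1 ^ 2 + t2 ^ 2) • (p * X * p + (1 - p) * X * (1 - p)) +
        (2 * t1 * t2) • (p * X * (1 - p) + (1 - p) * X * p) := by
    generalize 1 - p = q
    simp only [add_mul, mul_add, smul_mul_assoc, mul_smul_comm]
    module
  rw [hΩ, hτ]
  conv_lhs => enter [1]; rw [hX]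
  push_cast
  module

/-- The coherence relative to a weak measurement is a multiple of the Wigner-Yanase skew
information of `P ⊗ 1`. -/
theorem coherence_eq {a b : Type*} [Fintype a] [DecidableEq a] [Fintype b] [DecidableEq b]
    (x : ℝ) {P Q : Matrix a a ℂ} (h : IsProjectorPair P Q) {ρ : Matrix (a × b) (a × b) ℂ}
    (hρ : ρ.PosSemidef) :
    coherence x P Q ρ = 2 * (1 - 2 * tau1 x * tau2 x) ^ 2 *
      (((P ⊗ₖ (1 : Matrix b b ℂ)) * ρ).trace.re -
        ((P ⊗ₖ (1 : Matrix b b ℂ)) * CFC.sqrt ρ * (P ⊗ₖ (1 : Matrix b b ℂ)) *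
          CFC.sqrt ρ).trace.re) := by
  have hpp : (P ⊗ₖ (1 : Matrix b b ℂ)) * (P ⊗ₖ (1 : Matrix b b ℂ)) = P ⊗ₖ (1 : Matrix b b ℂ) := by
    rw [← mul_kronecker_mul, h.mul_self, Matrix.one_mul]
  have hps : (P ⊗ₖ (1 : Matrix b b ℂ))ᴴ = P ⊗ₖ (1 : Matrix b b ℂ) := by
    rw [conjTranspose_kronecker, h.conjTranspose_eq, conjTranspose_one]
  have hRs : (CFC.sqrt ρ)ᴴ = CFC.sqrt ρ :=
    (nonneg_iff_posSemidef.1 (CFC.sqrt_nonneg ρ)).isHermitian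
  have hRR : CFC.sqrt ρ * CFC.sqrt ρ = ρ := CFC.sqrt_mul_sqrt_self ρ hρ.nonneg
  rw [coherence, sub_weakMeasure x h]
  set p := P ⊗ₖ (1 : Matrix b b ℂ)
  set R := CFC.sqrt ρ
  set s : ℝ := 1 - 2 * tau1 x * tau2 x
  have hnn : ∀ O : Matrix (a × b) (a × b) ℂ, 0 ≤ (Oᴴ * O).trace.re := fun O =>
    (Complex.le_def.1 (posSemidef_conjTranspose_mul_self O).trace_nonneg).1
  rw [hsNorm, Real.sq_sqrt (hnn _)]
  have e1 : ((s : ℂ) • (p * R * (1 - p) + (1 - p) * R * p))ᴴ =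
      (s : ℂ) • (p * R * (1 - p) + (1 - p) * R * p) := by
    simp only [conjTranspose_smul, conjTranspose_add, conjTranspose_mul, conjTranspose_sub,
      conjTranspose_one, hps, hRs, Complex.star_def, Complex.conj_ofReal, Matrix.mul_assoc]
    rw [add_comm]
  -- Each of the two summands has trace tr pρ - tr pRpR, whence the factor 2.
  have e2 : (p * R * (1 - p) + (1 - p) * R * p) * (p * R * (1 - p) + (1 - p) * R * p) =
      p * (R * R * p - R * p * R * p) + (R * p * R - p * R * p * R) * (1 - p) := by
    have hpp' : ∀ Y, p * (p * Y) = p * Y := fun Y => by rw [← mul_assoc, hpp]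
    simp only [mul_add, add_mul, mul_sub, sub_mul, mul_one, one_mul, mul_assoc, hpp']
    abel
  have hc1 : (p * (R * R * p)).trace = (p * ρ).trace := by
    rw [hRR, ← mul_assoc, trace_mul_comm, ← mul_assoc, hpp]
  have hc2 : (p * (R * p * R * p)).trace = (p * R * p * R).trace := by
    rw [trace_mul_comm, mul_assoc _ p p, hpp, trace_mul_comm]; simp only [mul_assoc]
  have hc3 : (R * p * R).trace = (p * ρ).trace := by
    rw [mul_assoc, trace_mul_comm, mul_assoc, hRR]
  have hc4 : (R * p * R * p).trace = (p * R * p * R).trace := by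
    rw [trace_mul_comm]; simp only [mul_assoc]
  have hc5 : (p * R * p * R * p).trace = (p * R * p * R).trace := by
    rw [trace_mul_comm]; simp only [← mul_assoc, hpp]
  rw [e1, smul_mul_smul_comm, e2, trace_smul, trace_add, mul_sub p, trace_sub, hc1, hc2,
    mul_sub _ 1 p, sub_mul _ _ p, trace_sub, mul_one, trace_sub, trace_sub, hc3, hc4, hc5,
    ← Complex.ofReal_mul, smul_eq_mul, Complex.re_ofReal_mul]
  simp only [Complex.add_re, Complex.sub_re]
  ring

/-! ### Marginals -/

theorem trace_kronecker_one_mul {a b : Type*} [Fintype a] [Fintype b] [DecidableEq b]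
    (P : Matrix a a ℂ) (ρ : Matrix (a × b) (a × b) ℂ) :
    ((P ⊗ₖ (1 : Matrix b b ℂ)) * ρ).trace = (P * marginalA ρ).trace := by
  simp only [trace, diag_apply, mul_apply, Fintype.sum_prod_type, kroneckerMap_apply, one_apply,
    marginalA, of_apply, mul_ite, mul_one, mul_zero, ite_mul, zero_mul, Finset.sum_ite_eq,
    Finset.mem_univ, if_true, Finset.mul_sum]
  exact Finset.sum_congr rfl fun i _ => Finset.sum_comm

theorem marginalA_posSemidef {a b : Type*} [Fintype a] [Fintype b]
    {ρ : Matrix (a × b) (a × b) ℂ} (hρ : ρ.PosSemidef) : (marginalA ρ).PosSemidef := by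
  have : marginalA ρ = ∑ j, ρ.submatrix (fun i => (i, j)) fun i => (i, j) := by
    ext i i'; simp [marginalA, Matrix.sum_apply]
  rw [this]
  exact posSemidef_sum _ fun j _ => hρ.submatrix _

theorem marginalB_posSemidef {a b : Type*} [Fintype a] [Fintype b]
    {ρ : Matrix (a × b) (a × b) ℂ} (hρ : ρ.PosSemidef) : (marginalB ρ).PosSemidef := by
  have : marginalB ρ = ∑ i, ρ.submatrix (fun j => (i, j)) fun j => (i, j) := by
    ext i i'; simp [marginalB, Matrix.sum_apply]
  rw [this]
  exact posSemidef_sum _ fun j _ => hρ.submatrix _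

theorem trace_marginalA {a b : Type*} [Fintype a] [Fintype b] (ρ : Matrix (a × b) (a × b) ℂ) :
    (marginalA ρ).trace = ρ.trace := by
  simp [trace, marginalA, Fintype.sum_prod_type]

theorem trace_marginalB {a b : Type*} [Fintype a] [Fintype b] (ρ : Matrix (a × b) (a × b) ℂ) :
    (marginalB ρ).trace = ρ.trace := by
  simp [trace, marginalB, Fintype.sum_prod_type_right]

/-- Makes the linear terms of ρ and ρᵃ ⊗ ρᵇ agree, since tr ρᵇ = 1. -/
theorem marginalA_kronecker {a b : Type*} [Fintype b] (A : Matrix a a ℂ) (B : Matrix b b ℂ) :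
    marginalA (A ⊗ₖ B) = B.trace • A := by
  ext i i'
  simp [marginalA, trace, Finset.mul_sum, mul_comm]

/-- A trace preserving map on the second subsystem does not change the first marginal. -/
theorem marginalA_idTensor {a b c : Type*} [Fintype b] [Fintype c]
    {Φ : Matrix b b ℂ →ₗ[ℂ] Matrix c c ℂ} (hΦ : IsCPTP Φ) (ρ : Matrix (a × b) (a × b) ℂ) :
    marginalA (idTensor a Φ ρ) = marginalA ρ := by
  ext i i'
  exact hΦ.tracePreserving (Matrix.of fun j j' => ρ (i, j) (i', j'))

/-! ### Attainment of the minimum -/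

/-- Weak measurements form a compact family. -/
theorem isCompact_projectorPair (a : Type*) [Fintype a] [DecidableEq a] :
    IsCompact {p : Matrix a a ℂ × Matrix a a ℂ | IsProjectorPair p.1 p.2} := by
  -- P ≠ 0 is not a closed condition, but a nonzero projection has operator norm 1 by the
  -- C*-identity, so it can be replaced by ‖P‖ = 1.
  open scoped Matrix.Norms.L2Operator in
  have h1 : ∀ P : Matrix a a ℂ, IsStarProjection P → P ≠ 0 → ‖P‖ = 1 := fun P hP h0 => by
    have h2 := CStarRing.norm_star_mul_self (x := P)
    rw [hP.isSelfAdjoint.star_eq, hP.isIdempotentElem.eq] at h2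
    have := norm_ne_zero_iff.2 h0
    field_simp at h2
    exact h2.symm
  have h3 : {p : Matrix a a ℂ × Matrix a a ℂ | IsProjectorPair p.1 p.2} =
      (Metric.sphere 0 1 ×ˢ Metric.sphere 0 1) ∩
      {p | p.1 * p.1 = p.1 ∧ star p.1 = p.1 ∧ p.2 * p.2 = p.2 ∧ star p.2 = p.2 ∧
        p.1 + p.2 = 1} := by
    ext ⟨P, Q⟩
    simp only [Set.mem_ofPred_eq, Set.mem_inter_iff, Set.mem_prod, mem_sphere_zero_iff_norm]
    constructor
    · intro h
      exact ⟨⟨h1 _ h.left_proj h.left_ne_zero, h1 _ h.right_proj h.right_ne_zero⟩,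
        h.left_proj.isIdempotentElem, h.left_proj.isSelfAdjoint, h.right_proj.isIdempotentElem,
        h.right_proj.isSelfAdjoint, h.add_eq_one⟩
    · rintro ⟨⟨hP, hQ⟩, h2, h3, h4, h5, h6⟩
      exact ⟨⟨h2, h3⟩, ⟨h4, h5⟩, h6, norm_ne_zero_iff.1 (by rw [hP]; exact one_ne_zero),
        norm_ne_zero_iff.1 (by rw [hQ]; exact one_ne_zero)⟩
  have : ProperSpace (Matrix a a ℂ) := FiniteDimensional.proper ℂ _
  rw [h3]
  refine ((isCompact_sphere _ _).prod (isCompact_sphere _ _)).inter_right ?_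
  refine (isClosed_eq (by fun_prop) (by fun_prop)).inter ((isClosed_eq (by fun_prop)
    (by fun_prop)).inter ((isClosed_eq (by fun_prop) (by fun_prop)).inter
    ((isClosed_eq (by fun_prop) (by fun_prop)).inter
      (isClosed_eq (by fun_prop) (by fun_prop)))))

/-- Here dim a ≥ 2 enters: the complement of a rank-one projector must be nonzero. -/
theorem exists_isProjectorPair (a : Type*) [Fintype a] [DecidableEq a] [Nontrivial a] :
    ∃ P Q : Matrix a a ℂ, IsProjectorPair P Q := by
  obtain ⟨i, j, hij⟩ := exists_pair_ne a
  have hP : IsStarProjection (single i i (1 : ℂ)) :=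
    ⟨by simp [IsIdempotentElem], by simp [IsSelfAdjoint, star_eq_conjTranspose]⟩
  refine ⟨single i i 1, 1 - single i i 1, hP, hP.one_sub, by abel, fun h => ?_, fun h => ?_⟩
  · simpa using congrFun (congrFun h i) i
  · simpa [hij] using congrFun (congrFun h j) j

theorem continuous_coherence {a b : Type*} [Fintype a] [DecidableEq a] [Fintype b] [DecidableEq b]
    (x : ℝ) (ρ : Matrix (a × b) (a × b) ℂ) :
    Continuous fun p : Matrix a a ℂ × Matrix a a ℂ => coherence x p.1 p.2 ρ := by
  have hk : Continuous fun P : Matrix a a ℂ => P ⊗ₖ (1 : Matrix b b ℂ) :=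
    continuous_matrix fun p q => (continuous_id.matrix_elem p.1 q.1).mul continuous_const
  have h1 : Continuous fun p : Matrix a a ℂ × Matrix a a ℂ => weakPlus x p.1 p.2 := by
    unfold weakPlus; fun_prop
  have h2 : Continuous fun p : Matrix a a ℂ × Matrix a a ℂ => weakMinus x p.1 p.2 := by
    unfold weakMinus; fun_prop
  have h3 := hk.comp h1
  have h4 := hk.comp h2
  have h5 : Continuous fun p : Matrix a a ℂ × Matrix a a ℂ =>
      CFC.sqrt ρ - weakMeasure x p.1 p.2 (CFC.sqrt ρ) :=
    continuous_const.sub (((h3.matrix_mul continuous_const).matrix_mul h3).add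
      ((h4.matrix_mul continuous_const).matrix_mul h4))
  have h6 : Continuous fun O : Matrix (a × b) (a × b) ℂ => hsNorm O :=
    Real.continuous_sqrt.comp (Complex.continuous_re.comp
      (continuous_id.matrix_conjTranspose.matrix_mul continuous_id).matrix_trace)
  exact (h6.comp h5).pow 2

/-- The minimum defining `Qw` is attained. -/
theorem isLeast_Qw {a b : Type*} [Fintype a] [DecidableEq a] [Nontrivial a] [Fintype b]
    [DecidableEq b] (x : ℝ) (ρ : Matrix (a × b) (a × b) ℂ) :
    IsLeast (DeltaValues x ρ) (Qw x ρ) := by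
  have himg : DeltaValues x ρ = (fun p : Matrix a a ℂ × Matrix a a ℂ => Delta x p.1 p.2 ρ) ''
      {p | IsProjectorPair p.1 p.2} := by
    ext r
    constructor
    · rintro ⟨P, Q, h, rfl⟩
      exact ⟨(P, Q), h, rfl⟩
    · rintro ⟨⟨P, Q⟩, h, rfl⟩
      exact ⟨P, Q, h, rfl⟩
  rw [Qw, himg]
  obtain ⟨P, Q, h⟩ := exists_isProjectorPair a
  exact ((isCompact_projectorPair a).image
    ((continuous_coherence x ρ).sub (continuous_coherence x _))).isLeast_sInf
      ⟨_, (P, Q), h, rfl⟩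

/-! ### Monotonicity of Δ_w and Q_w -/

/-- For a state, `Δ_w` compares the overlaps `tr (√σ P √σ P)` of the state and its marginal. -/
theorem Delta_eq {a b : Type*} [Fintype a] [DecidableEq a] [Fintype b] [DecidableEq b]
    (x : ℝ) {P Q : Matrix a a ℂ} (h : IsProjectorPair P Q) {ρ : Matrix (a × b) (a × b) ℂ}
    (hρ : IsState ρ) :
    Delta x P Q ρ = 2 * (1 - 2 * tau1 x * tau2 x) ^ 2 *
      ((P * CFC.sqrt (marginalA ρ) * P * CFC.sqrt (marginalA ρ)).trace.re -
        ((P ⊗ₖ (1 : Matrix b b ℂ)) * CFC.sqrt ρ * (P ⊗ₖ (1 : Matrix b b ℂ)) *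
          CFC.sqrt ρ).trace.re) := by
  have hA := marginalA_posSemidef hρ.1
  have hB := marginalB_posSemidef hρ.1
  have hB1 : (marginalB ρ).trace = 1 := (trace_marginalB ρ).trans hρ.2
  rw [Delta, coherence_eq x h hρ.1, coherence_eq x h (hA.kronecker hB), sqrt_kronecker hA hB,
    trace_kronecker_one_mul, trace_kronecker_one_mul, marginalA_kronecker, hB1, one_smul]
  simp only [← mul_kronecker_mul, Matrix.one_mul, sqrt_mul_sqrt hB,
    trace_kronecker, hB1, mul_one]
  ring

theorem isState_idTensor {a b c : Type*} [Fintype a] [DecidableEq a] [Fintype b] [DecidableEq b]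
    [Fintype c] [DecidableEq c] {Φ : Matrix b b ℂ →ₗ[ℂ] Matrix c c ℂ} (hΦ : IsCPTP Φ)
    {ρ : Matrix (a × b) (a × b) ℂ} (hρ : IsState ρ) : IsState (idTensor a Φ ρ) :=
  ⟨idTensor_posSemidef hΦ hρ.1, by
    rw [← trace_marginalA, marginalA_idTensor hΦ, trace_marginalA, hρ.2]⟩

/-- `Δ_w` does not increase under a CPTP map on the second subsystem. -/
theorem Delta_idTensor_le {a b c : Type*} [Fintype a] [DecidableEq a] [Fintype b] [DecidableEq b]
    [Fintype c] [DecidableEq c] (x : ℝ) {P Q : Matrix a a ℂ} (h : IsProjectorPair P Q)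
    {Φ : Matrix b b ℂ →ₗ[ℂ] Matrix c c ℂ} (hΦ : IsCPTP Φ) {ρ : Matrix (a × b) (a × b) ℂ}
    (hρ : IsState ρ) : Delta x P Q (idTensor a Φ ρ) ≤ Delta x P Q ρ := by
  rw [Delta_eq x h hρ, Delta_eq x h (isState_idTensor hΦ hρ), marginalA_idTensor hΦ]
  have := re_trace_sqrt_idTensor_le hΦ hρ.1 h.conjTranspose_eq
  gcongr

end WeakCorrelation

/-- The quantum correlation `Q_w` (whose defining minima are attained) does not increase under a
CPTP map acting on subsystem `b`. -/
theorem mainTheorem9 {a b c : Type*} [Fintype a] [DecidableEq a] [Nontrivial a]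
    [Fintype b] [DecidableEq b] [Fintype c] [DecidableEq c] (x : ℝ)
    (ρ : Matrix (a × b) (a × b) ℂ) (hρ : WeakCorrelation.IsState ρ)
    (Φ : Matrix b b ℂ →ₗ[ℂ] Matrix c c ℂ) (hΦ : WeakCorrelation.IsCPTP Φ) :
    IsLeast (WeakCorrelation.DeltaValues x ρ) (WeakCorrelation.Qw x ρ) ∧
    IsLeast (WeakCorrelation.DeltaValues x (WeakCorrelation.idTensor a Φ ρ))
      (WeakCorrelation.Qw x (WeakCorrelation.idTensor a Φ ρ)) ∧
    WeakCorrelation.Qw x (WeakCorrelation.idTensor a Φ ρ) ≤ WeakCorrelation.Qw x ρ := by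
  have h1 := WeakCorrelation.isLeast_Qw x ρ
  have h2 := WeakCorrelation.isLeast_Qw x (WeakCorrelation.idTensor a Φ ρ)
  refine ⟨h1, h2, ?_⟩
  obtain ⟨P, Q, hPQ, hmin⟩ := h1.1
  rw [hmin]
  exact (h2.2 ⟨P, Q, hPQ, rfl⟩).trans (WeakCorrelation.Delta_idTensor_le x hPQ hΦ hρ)
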